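/- **Lemma (subgaussian data is good).** For a real random variable $f$ let $\|f\|_{\psi_2}=\inf\{t>0:\mathbb{E}\exp(f^2/t^2)\le 2\}$ (with $\inf\emptyset=\infty$). A distribution on $\mathbb{R}^m$ with mean $\mu$ and covariance $\Sigma$ is *subgaussian with parameter $K\ge 1$* if $\|\langle x-\mu,v\rangle\|_{\psi_2}\le K\sqrt{v^\top\Sigma v}$ for all $v\in\mathbb{R}^m$, where $x$ has that distribution. A dataset $(X,y)\in\mathbb{R}^{n\times d}\times\mathbb{R}^n$, with rows $x_1,\dots,x_n$ of $X$, is *$(L,R)$-good* if $X^\top X$ is invertible and for every $i\in\{1,\dots,n\}$ $$x_i^\top (X^\top X)^{-1}x_i\le L\qquad\text{and}\qquad |\langle x_i,\beta_{\mathrm{ols}}\rangle-y_i|\le R,\qquad\text{where } \beta_{\mathrm{ols}}=(X^\top X)^{-1}X^\top y .$$ There exist absolute constants $K_L,K_R,K_n>0$ such that the following holds. Let $x_1,\dots,x_n$ be i.i.d. from a distribution $\mathcal{D}$ on $\mathbb{R}^d$ with mean $0$ and full-rank covariance that is subgaussian with parameter $K_{\mathcal{D}}$. Let $z_1,\dots,z_n$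 be i.i.d., independent of $x_1,\dots,x_n$, from a distribution on $\mathbb{R}$ with mean $0$ and variance $\sigma^2$ (with $\sigma\ge 0$) that is subgaussian with parameter $K_\sigma$. Let $\beta\in\mathbb{R}^d$, $y_i=\beta^\top x_i+z_i$, and $\eta\in(0,1)$. If $n\ge K_nK_{\mathcal{D}}^4\,(d+\log(3/\eta))$, then with probability at least $1-\eta$ the dataset $(X,y)$ is $(L,R)$-good with $$L=K_LK_{\mathcal{D}}^2\cdot\frac{d+\log(3n/\eta)}{n}\qquad\text{and}\qquad R=K_RK_\sigma\,\sigma\sqrt{\log(3n/\eta)} .$$ -/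

import Mathlib

open MeasureTheory ProbabilityTheory
open scoped ENNReal Matrix

noncomputable section

/-- The ordinary least-squares coefficients
`β_ols = (Xᵀ X)⁻¹ Xᵀ y`. -/
def olsEstimator {n d : ℕ} (X : Matrix (Fin n) (Fin d) ℝ) (y : Fin n → ℝ) : Fin d → ℝ :=
  (Xᵀ * X)⁻¹ *ᵥ (Xᵀ *ᵥ y)

/-- `(L, R)`-goodness of a regression dataset `(X, y)`; the rows of `X` are the covariates. -/
structure IsGood {n d : ℕ} (X : Matrix (Fin n) (Fin d) ℝ) (y : Fin n → ℝ) (L R : ℝ) : Prop where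
  isUnit_gram : IsUnit (Xᵀ * X)
  leverage_le : ∀ i, X i ⬝ᵥ ((Xᵀ * X)⁻¹ *ᵥ X i) ≤ L
  residual_le : ∀ i, |X i ⬝ᵥ olsEstimator X y - y i| ≤ R

/-- The subgaussian (`ψ₂`) norm `inf {t > 0 : 𝔼 exp (f² / t²) ≤ 2}` of a real random variable,
with value `∞` if there is no such `t`. -/
def psi2Norm {Ω : Type*} [MeasurableSpace Ω] (f : Ω → ℝ) (P : Measure Ω) : ℝ≥0∞ :=
  sInf {s : ℝ≥0∞ | ∃ t : ℝ, 0 < t ∧ s = ENNReal.ofReal t ∧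
    ∫⁻ ω, ENNReal.ofReal (Real.exp (f ω ^ 2 / t ^ 2)) ∂P ≤ 2}

/-- The distribution `P` (with finite second moments, so that its mean and covariance exist) is
subgaussian with parameter `K`: every linear functional `v` of the centred variable has `ψ₂`-norm
at most `K √(vᵀ Σ v)`, with `Σ` the covariance of `P`. The case `E = ℝ` is the one-dimensional
case; for `E = ℝᵈ` see `covarianceBilin_eq_covMatrix`. -/
structure IsSubgaussian {E : Type*} [NormedAddCommGroup E] [InnerProductSpace ℝ E]
    [MeasurableSpace E] [BorelSpace E] (P : Measure E) (K : ℝ) : Prop where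
  memLp : MemLp id 2 P
  one_le : 1 ≤ K
  psi2Norm_le : ∀ v : E,
    psi2Norm (fun x => inner ℝ (x - ∫ x', x' ∂P) v) P
      ≤ ENNReal.ofReal (K * √(covarianceBilin P v v))

/-- The covariance matrix of a distribution on `ℝᵈ`. -/
def covMatrix {d : ℕ} (P : Measure (EuclideanSpace ℝ (Fin d))) : Matrix (Fin d) (Fin d) ℝ :=
  Matrix.of fun i j => cov[fun x => x i, fun x => x j; P]

/-- The covariance form used in `IsSubgaussian` is the quadratic form of the covariance matrix. -/
theorem covarianceBilin_eq_covMatrix {d : ℕ} (P : Measure (EuclideanSpace ℝ (Fin d)))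
    [IsFiniteMeasure P] (h : MemLp id 2 P) (v : EuclideanSpace ℝ (Fin d)) :
    covarianceBilin P v v = v.ofLp ⬝ᵥ (covMatrix P *ᵥ v.ofLp) := by
  have hX : ∀ i, MemLp (fun x : EuclideanSpace ℝ (Fin d) => x i) 2 P := fun i =>
    (EuclideanSpace.proj (𝕜 := ℝ) i).comp_memLp' h
  have := covarianceBilin_apply_pi (μ := P) (X := fun i x => x i) hX v v
  have hid : P.map (fun ω : EuclideanSpace ℝ (Fin d) => WithLp.toLp 2 (fun i => ω i)) = P :=
    Measure.map_id
  rw [hid] at this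
  rw [this]
  simp only [dotProduct, Matrix.mulVec, covMatrix, Matrix.of_apply, Finset.mul_sum]
  refine Finset.sum_congr rfl fun i _ => Finset.sum_congr rfl fun j _ => by ring

/-- In one dimension the covariance form is `v² · Var`. -/
theorem covarianceBilin_eq_variance (P : Measure ℝ) [IsFiniteMeasure P] (v : ℝ) :
    covarianceBilin P v v = v ^ 2 * Var[id; P] := by
  rw [covarianceBilin_real]; ring

end

/-! Leverages and Gram invertibility are unchanged by a linear change of coordinates, so the
covariates may be whitened (`exists_whitening`). Two net arguments then control the design:
Bernstein's inequality gives a Gram form of at least `n / 2` in every direction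
(`measureReal_not_half_le_gram`), and a Markov tail bounds all whitened norms
(`measureReal_exists_norm_sq_gt_le`). Cauchy–Schwarz bounds each leverage by squared norm over `n /
2`.

The residual vector is minus the noise projected off the column space of `X`, so the signal
disappears (`residual_eq`). Rows of an orthogonal projection have norm at most one; with the design
frozen by independence, each residual is thus a subgaussian combination of the noise with no
dependence on `d` (`measureReal_exists_residual_gt_le`). Each of the three bad events costs `η / 3`.
-/

theorem integrable_exp_of_psi2Norm_lt {Ω : Type*} [MeasurableSpace Ω] {P : Measure Ω} {f : Ω → ℝ}
    (hf : AEMeasurable f P) {T : ℝ} (h : psi2Norm f P < ENNReal.ofReal T) :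
    Integrable (fun ω => Real.exp (f ω ^ 2 / T ^ 2)) P ∧
      ∫ ω, Real.exp (f ω ^ 2 / T ^ 2) ∂P ≤ 2 := by
  -- Strictness supplies an admissible `t < T`, so the infimum need not be attained; later scales
  -- carry a factor 2 for this slack.
  obtain ⟨_, ⟨t, ht, rfl, hle⟩, hlt⟩ := sInf_lt_iff.1 h
  have htT : t < T := (ENNReal.ofReal_lt_ofReal_iff_of_nonneg ht.le).1 hlt
  have hmeas : AEStronglyMeasurable (fun ω => Real.exp (f ω ^ 2 / T ^ 2)) P :=
    (Real.measurable_exp.comp_aemeasurable ((hf.pow_const 2).div_const _)).aestronglyMeasurable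
  have hle' : ∫⁻ ω, ENNReal.ofReal (Real.exp (f ω ^ 2 / T ^ 2)) ∂P ≤ 2 :=
    (lintegral_mono fun ω => by gcongr).trans hle
  have hnn : 0 ≤ᵐ[P] fun ω => Real.exp (f ω ^ 2 / T ^ 2) :=
    ae_of_all _ fun ω => (Real.exp_pos _).le
  refine ⟨⟨hmeas, ?_⟩, ?_⟩
  · rw [hasFiniteIntegral_iff_ofReal hnn]
    exact hle'.trans_lt (by simp)
  · rw [integral_eq_lintegral_of_nonneg_ae hnn hmeas]
    exact ENNReal.toReal_le_of_le_ofReal (by norm_num) (by simpa using hle')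

/-! ### Elementary exponential inequalities -/

theorem exp_le_one_add_add_sq_mul_exp_abs (x : ℝ) :
    Real.exp x ≤ 1 + x + x ^ 2 * Real.exp |x| := by
  have h := Complex.norm_exp_sub_sum_le_norm_mul_exp (x : ℂ) 2
  simp only [Finset.sum_range_succ, Finset.sum_range_zero] at h
  norm_num at h
  have h2 : Complex.exp x - (1 + x) = ((Real.exp x - (1 + x) : ℝ) : ℂ) := by push_cast; rfl
  rw [h2, Complex.norm_real, Real.norm_eq_abs] at h
  linarith [le_abs_self (Real.exp x - (1 + x))]

theorem sq_mul_exp_half_le {s : ℝ} (hs : 0 ≤ s) : s ^ 2 * Real.exp (s / 2) ≤ 8 * Real.exp s := by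
  have h := Real.quadratic_le_exp_of_nonneg (x := s / 2) (by positivity)
  have h2 : Real.exp s = Real.exp (s / 2) * Real.exp (s / 2) := by rw [← Real.exp_add]; ring_nf
  rw [h2]
  nlinarith [Real.exp_pos (s / 2)]

/-- Since `|l| ≤ 1 / 2`, half of the exponent is left to absorb `s ^ 2`. The linear term stays
exact, so that integration produces the true mean. -/
theorem exp_mul_le_of_abs_le_half {l s : ℝ} (hl : |l| ≤ 1 / 2) (hs : 0 ≤ s) :
    Real.exp (l * s) ≤ 1 + l * s + 8 * l ^ 2 * Real.exp s := by
  have h1 := exp_le_one_add_add_sq_mul_exp_abs (l * s)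
  have h2 : |l * s| ≤ s / 2 := by
    rw [abs_mul, abs_of_nonneg hs]; nlinarith
  have h3 : (l * s) ^ 2 * Real.exp |l * s| ≤ 8 * l ^ 2 * Real.exp s := by
    calc (l * s) ^ 2 * Real.exp |l * s| ≤ (l * s) ^ 2 * Real.exp (s / 2) := by gcongr
      _ = l ^ 2 * (s ^ 2 * Real.exp (s / 2)) := by ring
      _ ≤ l ^ 2 * (8 * Real.exp s) := by
        gcongr ?_ * ?_
        exact sq_mul_exp_half_le hs
      _ = _ := by ring
  linarith

/-- For a centred variable the linear term integrates to zero, leaving only the square-exponential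
moment. -/
theorem exp_le_add_exp_sq (x : ℝ) : Real.exp x ≤ x + Real.exp (x ^ 2) := by
  have h2 := Real.add_one_le_exp (x ^ 2)
  rcases le_or_gt |x| 1 with h | h
  · have := (abs_le.1 (Real.abs_exp_sub_one_sub_id_le h)).2
    linarith
  · rcases lt_abs.1 h with h | h
    · have : Real.exp x ≤ Real.exp (x ^ 2) := Real.exp_le_exp.2 (by nlinarith)
      linarith
    · have : Real.exp x ≤ 1 := Real.exp_le_one_iff.2 (by linarith)
      nlinarith

theorem exp_mul_le_convex {t s : ℝ} (ht : 0 ≤ t) (ht1 : t ≤ 1) :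
    Real.exp (t * s) ≤ 1 - t + t * Real.exp s := by
  have := convexOn_exp.2 (Set.mem_univ (0 : ℝ)) (Set.mem_univ s) (sub_nonneg.2 ht1) ht (by ring)
  simpa using this

/-! ### Moment generating functions and tails -/

section mgf

variable {Ω : Type*} [MeasurableSpace Ω] {P : Measure Ω}

theorem integrable_of_integrable_exp [IsFiniteMeasure P] {s : Ω → ℝ} (hs : AEMeasurable s P) (hs0 : ∀ ω, 0 ≤ s ω)
    (hi : Integrable (fun ω => Real.exp (s ω)) P) : Integrable s P :=
  hi.mono' hs.aestronglyMeasurable (ae_of_all _ fun ω => by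
    rw [Real.norm_eq_abs, abs_of_nonneg (hs0 ω)]; linarith [Real.add_one_le_exp (s ω)])

variable [IsProbabilityMeasure P]

theorem mgf_le_of_integral_exp_le_two {s : Ω → ℝ} (hs : AEMeasurable s P) (hs0 : ∀ ω, 0 ≤ s ω)
    (hi : Integrable (fun ω => Real.exp (s ω)) P) (h2 : ∫ ω, Real.exp (s ω) ∂P ≤ 2)
    {l : ℝ} (hl : |l| ≤ 1 / 2) :
    Integrable (fun ω => Real.exp (l * s ω)) P ∧
      mgf s P l ≤ Real.exp (l * ∫ ω, s ω ∂P + 16 * l ^ 2) := by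
  have hsi := integrable_of_integrable_exp hs hs0 hi
  have hint : Integrable (fun ω => Real.exp (l * s ω)) P :=
    hi.mono' (Real.measurable_exp.comp_aemeasurable (hs.const_mul l)).aestronglyMeasurable
      (ae_of_all _ fun ω => by
        rw [Real.norm_eq_abs, abs_of_pos (Real.exp_pos _)]
        gcongr
        nlinarith [hs0 ω, le_abs_self l])
  refine ⟨hint, ?_⟩
  have hb : Integrable (fun ω => 1 + l * s ω + 8 * l ^ 2 * Real.exp (s ω)) P :=
    ((integrable_const _).add (hsi.const_mul l)).add (hi.const_mul _)
  calc mgf s P l ≤ ∫ ω, (1 + l * s ω + 8 * l ^ 2 * Real.exp (s ω)) ∂P :=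
        integral_mono hint hb fun ω => exp_mul_le_of_abs_le_half hl (hs0 ω)
    _ = 1 + l * ∫ ω, s ω ∂P + 8 * l ^ 2 * ∫ ω, Real.exp (s ω) ∂P := by
        rw [integral_add (f := fun ω => 1 + l * s ω) ((integrable_const _).add (hsi.const_mul l))
          (hi.const_mul _), integral_add (integrable_const _) (hsi.const_mul l), integral_const_mul,
          integral_const_mul]
        simp
    _ ≤ l * ∫ ω, s ω ∂P + 16 * l ^ 2 + 1 := by nlinarith [sq_nonneg l]
    _ ≤ _ := Real.add_one_le_exp _

theorem hasSubgaussianMGF_of_integral_exp_sq_le_two {f : Ω → ℝ} {T : ℝ} (hT : 0 < T)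
    (hf : AEMeasurable f P) (hfi : Integrable f P) (hf0 : ∫ ω, f ω ∂P = 0)
    (hi : Integrable (fun ω => Real.exp (f ω ^ 2 / T ^ 2)) P)
    (h2 : ∫ ω, Real.exp (f ω ^ 2 / T ^ 2) ∂P ≤ 2) :
    HasSubgaussianMGF f (2 * T ^ 2).toNNReal P := by
  have hhalf : ∀ (l : ℝ) ω, Real.exp (l * f ω) ≤
      Real.exp (l ^ 2 * T ^ 2 / 2) * (1 / 2 + 1 / 2 * Real.exp (f ω ^ 2 / T ^ 2)) := fun l ω => by
    have hc := exp_mul_le_convex (t := 1 / 2) (s := f ω ^ 2 / T ^ 2) (by norm_num) (by norm_num)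
    calc Real.exp (l * f ω) ≤ Real.exp (l ^ 2 * T ^ 2 / 2 + 1 / 2 * (f ω ^ 2 / T ^ 2)) := by
          gcongr
          have := sq_nonneg (l * T - f ω / T)
          have e : l * T * (f ω / T) = l * f ω := by field_simp
          have e2 : (f ω / T) ^ 2 = f ω ^ 2 / T ^ 2 := by rw [div_pow]
          nlinarith
      _ ≤ _ := by
          rw [Real.exp_add]
          gcongr
          linarith
  have hbi : ∀ l : ℝ, Integrable (fun ω => Real.exp (l ^ 2 * T ^ 2 / 2) *
      (1 / 2 + 1 / 2 * Real.exp (f ω ^ 2 / T ^ 2))) P := fun l =>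
    ((integrable_const _).add (hi.const_mul _)).const_mul _
  have hint : ∀ l : ℝ, Integrable (fun ω => Real.exp (l * f ω)) P := fun l =>
    (hbi l).mono' (Real.measurable_exp.comp_aemeasurable (hf.const_mul l)).aestronglyMeasurable
      (ae_of_all _ fun ω => by
        rw [Real.norm_eq_abs, abs_of_pos (Real.exp_pos _)]; exact hhalf l ω)
  refine ⟨hint, fun l => ?_⟩
  have hexp : ((2 * T ^ 2).toNNReal : ℝ) * l ^ 2 / 2 = l ^ 2 * T ^ 2 := by
    rw [Real.coe_toNNReal _ (by positivity)]; ring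
  rw [hexp]
  -- Small `l` uses centring and convexity of `exp`. For large `l`, `hhalf` (AM-GM) suffices: its
  -- prefactor `3 / 2` is at most `1 + l ^ 2 * T ^ 2 / 2`.
  rcases le_or_gt (l ^ 2 * T ^ 2) 1 with h | h
  · have hb : ∀ ω, Real.exp (l * f ω) ≤ l * f ω + ((1 - l ^ 2 * T ^ 2) +
        l ^ 2 * T ^ 2 * Real.exp (f ω ^ 2 / T ^ 2)) := fun ω => by
      have h1 := exp_le_add_exp_sq (l * f ω)
      have h2 := exp_mul_le_convex (t := l ^ 2 * T ^ 2) (s := f ω ^ 2 / T ^ 2) (by positivity) h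
      have e : l ^ 2 * T ^ 2 * (f ω ^ 2 / T ^ 2) = (l * f ω) ^ 2 := by field_simp
      rw [e] at h2
      linarith
    have hbi' : Integrable (fun ω => (1 - l ^ 2 * T ^ 2) +
        l ^ 2 * T ^ 2 * Real.exp (f ω ^ 2 / T ^ 2)) P :=
      (integrable_const _).add (hi.const_mul _)
    calc mgf f P l ≤ _ := integral_mono (hint l) ((hfi.const_mul l).add hbi') hb
      _ = (1 - l ^ 2 * T ^ 2) + l ^ 2 * T ^ 2 * ∫ ω, Real.exp (f ω ^ 2 / T ^ 2) ∂P := by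
        simp only [Pi.add_apply]
        rw [integral_add (hfi.const_mul l) hbi', integral_add (integrable_const _)
          (hi.const_mul _), integral_const_mul, integral_const_mul, hf0]
        simp
      _ ≤ l ^ 2 * T ^ 2 + 1 := by nlinarith [mul_nonneg (sq_nonneg l) (sq_nonneg T)]
      _ ≤ _ := Real.add_one_le_exp _
  · calc mgf f P l ≤ _ := integral_mono (hint l) (hbi l) (hhalf l)
      _ = Real.exp (l ^ 2 * T ^ 2 / 2) * (1 / 2 + 1 / 2 * ∫ ω, Real.exp (f ω ^ 2 / T ^ 2) ∂P) := by
        rw [integral_const_mul, integral_add (integrable_const _) (hi.const_mul _),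
          integral_const_mul]
        simp
      _ ≤ Real.exp (l ^ 2 * T ^ 2 / 2) * Real.exp (l ^ 2 * T ^ 2 / 2) := by
        gcongr
        have := Real.quadratic_le_exp_of_nonneg (x := l ^ 2 * T ^ 2 / 2) (by positivity)
        nlinarith
      _ = _ := by rw [← Real.exp_add]; ring_nf

/-- A two-sided Bernstein inequality for sums of nonnegative sub-exponential variables. -/
theorem measureReal_abs_sum_sub_le {n : ℕ} {s : Fin n → Ω → ℝ} (hind : iIndepFun s P)
    (hs : ∀ i, AEMeasurable (s i) P) (hs0 : ∀ i ω, 0 ≤ s i ω)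
    (hi : ∀ i, Integrable (fun ω => Real.exp (s i ω)) P)
    (h2 : ∀ i, ∫ ω, Real.exp (s i ω) ∂P ≤ 2) {m : ℝ} (hm : ∀ i, ∫ ω, s i ω ∂P = m)
    {δ : ℝ} (hδ0 : 0 ≤ δ) (hδ : δ ≤ 16) :
    P.real {ω | n * δ ≤ |∑ i, s i ω - n * m|} ≤ 2 * Real.exp (-(n * δ ^ 2 / 64)) := by
  have key : ∀ l : ℝ, |l| ≤ 1 / 2 → Integrable (fun ω => Real.exp (l * ∑ i, s i ω)) P ∧
      mgf (fun ω => ∑ i, s i ω) P l ≤ Real.exp (n * (l * m + 16 * l ^ 2)) := fun l hl => by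
    have hone := fun i => mgf_le_of_integral_exp_le_two (hs i) (hs0 i) (hi i) (h2 i) hl
    have e : (∑ i, s i) = fun ω => ∑ i, s i ω := by ext ω; simp
    have hm' : mgf (fun ω => ∑ i, s i ω) P l = ∏ i, mgf (s i) P l := by
      rw [← e, hind.mgf_sum₀ hs]
    refine ⟨?_, ?_⟩
    -- A non-integrable function has Bochner integral zero, so positivity of the product of mgfs
    -- forces integrability.
    · have hpos : 0 < mgf (fun ω => ∑ i, s i ω) P l := by
        rw [hm']
        exact Finset.prod_pos fun i _ => mgf_pos (hone i).1
      by_contra hc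
      exact hpos.ne' (integral_undef hc)
    · rw [hm', Real.exp_nat_mul]
      calc ∏ i, mgf (s i) P l ≤ ∏ _i : Fin n, Real.exp (l * m + 16 * l ^ 2) :=
            Finset.prod_le_prod (fun i _ => mgf_nonneg) fun i _ => by
              rw [← hm i]; exact (hone i).2
        _ = _ := by simp
  -- `l = δ / 32` minimises `16 * l ^ 2 - l * δ`, with value `-δ ^ 2 / 64`; `δ ≤ 16` keeps it in the
  -- admissible range.
  have hl1 : |δ / 32| ≤ 1 / 2 := by rw [abs_of_nonneg (by positivity)]; linarith
  have hl2 : |-(δ / 32)| ≤ 1 / 2 := by rwa [abs_neg]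
  have up := measure_ge_le_exp_mul_mgf (μ := P) (n * (m + δ)) (t := δ / 32) (by positivity)
    (key _ hl1).1
  have lo := measure_le_le_exp_mul_mgf (μ := P) (n * (m - δ)) (t := -(δ / 32))
    (by linarith [div_nonneg hδ0 (by norm_num : (0:ℝ) ≤ 32)]) (key _ hl2).1
  have up' : P.real {ω | n * (m + δ) ≤ ∑ i, s i ω} ≤ Real.exp (-(n * δ ^ 2 / 64)) := by
    refine up.trans ((mul_le_mul_of_nonneg_left (key _ hl1).2 (Real.exp_pos _).le).trans_eq ?_)
    rw [← Real.exp_add]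
    ring_nf
  have lo' : P.real {ω | ∑ i, s i ω ≤ n * (m - δ)} ≤ Real.exp (-(n * δ ^ 2 / 64)) := by
    refine lo.trans ((mul_le_mul_of_nonneg_left (key _ hl2).2 (Real.exp_pos _).le).trans_eq ?_)
    rw [← Real.exp_add]
    ring_nf
  calc P.real {ω | n * δ ≤ |∑ i, s i ω - n * m|}
      ≤ P.real ({ω | n * (m + δ) ≤ ∑ i, s i ω} ∪ {ω | ∑ i, s i ω ≤ n * (m - δ)}) := by
        refine measureReal_mono fun ω hω => ?_
        rcases le_abs.1 (show n * δ ≤ |∑ i, s i ω - n * m| from hω) with h | h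
        · exact Or.inl (show n * (m + δ) ≤ ∑ i, s i ω by linarith)
        · exact Or.inr (show ∑ i, s i ω ≤ n * (m - δ) by linarith)
    _ ≤ _ := measureReal_union_le _ _
    _ ≤ _ := by linarith

theorem measureReal_sq_gt_le {f : Ω → ℝ} {T : ℝ} (hT : 0 < T)
    (hi : Integrable (fun ω => Real.exp (f ω ^ 2 / T ^ 2)) P)
    (h2 : ∫ ω, Real.exp (f ω ^ 2 / T ^ 2) ∂P ≤ 2) (a : ℝ) :
    P.real {ω | T ^ 2 * a < f ω ^ 2} ≤ 2 * Real.exp (-a) := by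
  have h := mul_meas_ge_le_integral_of_nonneg
    (ae_of_all P fun ω => (Real.exp_pos (f ω ^ 2 / T ^ 2)).le) hi (Real.exp a)
  have hsub : P.real {ω | T ^ 2 * a < f ω ^ 2} ≤
      P.real {ω | Real.exp a ≤ Real.exp (f ω ^ 2 / T ^ 2)} :=
    measureReal_mono fun ω hω => Real.exp_le_exp.2 (by
      rw [le_div_iff₀ (by positivity)]
      linarith [show T ^ 2 * a < f ω ^ 2 from hω])
  rw [Real.exp_neg, ← div_eq_mul_inv, le_div_iff₀ (Real.exp_pos a)]
  nlinarith [Real.exp_pos a]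

end mgf

/-! ### Nets on the unit sphere -/

section net

variable {E : Type*} [NormedAddCommGroup E] [InnerProductSpace ℝ E]

/-- A `1 / 2`-separated subset of the sphere of largest cardinality is a net. Doubling it gives a
1-separated set in the ball of radius 2, the setting of the Besicovitch count. -/
theorem exists_half_net_sphere [FiniteDimensional ℝ E] : ∃ N : Finset E, N.card ≤ 5 ^ Module.finrank ℝ E ∧
    (∀ w ∈ N, ‖w‖ = 1) ∧ ∀ v : E, ‖v‖ = 1 → ∃ w ∈ N, ‖v - w‖ ≤ 1 / 2 := by
  classical
  let p : Finset E → Prop := fun s => (∀ w ∈ s, ‖w‖ = 1) ∧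
    ∀ c ∈ s, ∀ d ∈ s, c ≠ d → 1 / 2 ≤ ‖c - d‖
  have hcard : ∀ s, p s → s.card ≤ 5 ^ Module.finrank ℝ E := fun s hs => by
    have hinj : Function.Injective fun v : E => (2 : ℝ) • v :=
      smul_right_injective E (by norm_num)
    have := Besicovitch.card_le_of_separated (s.image fun v => (2 : ℝ) • v) (by
      intro c hc
      obtain ⟨w, hw, rfl⟩ := Finset.mem_image.1 hc
      rw [norm_smul, hs.1 w hw]; norm_num) (by
      intro c hc d hd hcd
      obtain ⟨w, hw, rfl⟩ := Finset.mem_image.1 hc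
      obtain ⟨w', hw', rfl⟩ := Finset.mem_image.1 hd
      rw [← smul_sub, norm_smul, Real.norm_ofNat]
      linarith [hs.2 w hw w' hw' fun h => hcd (by rw [h])])
    rwa [Finset.card_image_of_injective _ hinj] at this
  let q : ℕ → Prop := fun k => ∃ s, p s ∧ s.card = k
  have hq0 : q 0 := ⟨∅, by simp [p], rfl⟩
  obtain ⟨N, hN, hNc⟩ := Nat.findGreatest_spec (P := q) (Nat.zero_le (5 ^ Module.finrank ℝ E)) hq0
  refine ⟨N, hcard N hN, hN.1, fun v hv => ?_⟩
  by_contra! hc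
  have hvN : v ∉ N := fun h => by have := hc v h; norm_num at this
  have hp : p (insert v N) := by
    refine ⟨fun w hw => ?_, fun c hc' d hd hcd => ?_⟩
    · rcases Finset.mem_insert.1 hw with rfl | hw
      exacts [hv, hN.1 w hw]
    · rcases Finset.mem_insert.1 hc' with rfl | hc'
      · rcases Finset.mem_insert.1 hd with rfl | hd
        · exact absurd rfl hcd
        · exact (hc d hd).le
      · rcases Finset.mem_insert.1 hd with hdv | hd
        · rw [hdv, norm_sub_rev]; exact (hc c hc').le
        · exact hN.2 c hc' d hd hcd
  have := Nat.le_findGreatest (P := q) (hcard _ hp) ⟨_, hp, rfl⟩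
  rw [← hNc, Finset.card_insert_of_notMem hvN] at this
  omega

/-- A net point `w` near the direction of `u` satisfies `‖u‖ / 2 ≤ ⟨u, w⟩`. -/
theorem norm_le_of_half_net {N : Finset E} (hN : ∀ v : E, ‖v‖ = 1 → ∃ w ∈ N, ‖v - w‖ ≤ 1 / 2)
    {u : E} {M : ℝ} (hM : 0 ≤ M) (h : ∀ w ∈ N, inner ℝ u w ^ 2 ≤ M) : ‖u‖ ^ 2 ≤ 4 * M := by
  rcases eq_or_ne u 0 with rfl | hu
  · simpa using hM
  have hu' : ‖u‖ ≠ 0 := norm_ne_zero_iff.2 hu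
  obtain ⟨w, hw, hvw⟩ := hN (‖u‖⁻¹ • u) (by rw [norm_smul, norm_inv, norm_norm, inv_mul_cancel₀ hu'])
  have h1 : inner ℝ u (‖u‖⁻¹ • u) = ‖u‖ := by
    rw [inner_smul_right, real_inner_self_eq_norm_sq]; field_simp
  have h2 : inner ℝ u (‖u‖⁻¹ • u - w) ≤ ‖u‖ * (1 / 2) :=
    (real_inner_le_norm _ _).trans (by gcongr)
  rw [inner_sub_right, h1] at h2
  have h3 := h w hw
  have h4 : ‖u‖ / 2 ≤ inner ℝ u w := by linarith
  nlinarith [norm_nonneg u]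

/-- A symmetric bilinear form that is small on a `1/2`-net of the sphere is small. -/
theorem abs_bilin_le_of_half_net [FiniteDimensional ℝ E] {N : Finset E} (hN1 : ∀ w ∈ N, ‖w‖ = 1)
    (hN : ∀ v : E, ‖v‖ = 1 → ∃ w ∈ N, ‖v - w‖ ≤ 1 / 2) (B : LinearMap.BilinForm ℝ E)
    (hB : ∀ x y, B x y = B y x) {ε : ℝ} (h : ∀ w ∈ N, |B w w| ≤ ε) (v : E) :
    |B v v| ≤ 32 * ε * ‖v‖ ^ 2 := by
  rcases subsingleton_or_nontrivial E with hE | hE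
  · rw [Subsingleton.elim v 0]; simp
  have hcont : Continuous fun v : E => |B v v| := by
    have h : (fun v : E => |B v v|) = fun v => |LinearMap.toContinuousBilinearMap B v v| := by
      ext v; simp
    rw [h]
    fun_prop
  have hhom : ∀ M, (∀ v : E, ‖v‖ = 1 → |B v v| ≤ M) → ∀ v, |B v v| ≤ M * ‖v‖ ^ 2 := by
    intro M hM v
    rcases eq_or_ne v 0 with rfl | hv
    · simp
    have hv' : ‖v‖ ≠ 0 := norm_ne_zero_iff.2 hv
    have := hM (‖v‖⁻¹ • v) (by rw [norm_smul, norm_inv, norm_norm, inv_mul_cancel₀ hv'])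
    rw [map_smul, map_smul, LinearMap.smul_apply, smul_eq_mul, smul_eq_mul, ← mul_assoc, abs_mul,
      abs_of_nonneg (by positivity)] at this
    have e : |B v v| = ‖v‖⁻¹ * ‖v‖⁻¹ * |B v v| * ‖v‖ ^ 2 := by field_simp
    rw [e]
    gcongr
  refine hhom _ (fun v hv => ?_) v
  obtain ⟨v₀, hv₀, hmax⟩ := (isCompact_sphere (0 : E) 1).exists_isMaxOn
    ((NormedSpace.sphere_nonempty (x := (0 : E)) (r := 1)).2 zero_le_one) hcont.continuousOn
  have hv₀' : ‖v₀‖ = 1 := by simpa using hv₀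
  have hle : ∀ v : E, ‖v‖ = 1 → |B v v| ≤ |B v₀ v₀| := fun v hv => hmax (by simpa using hv)
  refine (hle v hv).trans ?_
  set M := |B v₀ v₀| with hM
  have hM0 : 0 ≤ M := abs_nonneg _
  have hall := hhom M hle
  obtain ⟨w, hw, hvw⟩ := hN v₀ hv₀'
  have hw1 := hN1 w hw
  have hww := h w hw
  -- With `v₀` maximising `|B v v|`, the difference `B v₀ v₀ - B w w` is `B a b` for orthogonal `a`,
  -- `b`. Polarising with `4 • a` balances `‖a‖ ≤ 1 / 2` against `‖b‖ ≤ 2` and yields a factor `31 /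
  -- 32 < 1`, so `M` can be absorbed.
  set a := v₀ - w with ha
  set b := v₀ + w with hb
  have hpar : ‖a‖ ^ 2 + ‖b‖ ^ 2 = 4 := by
    have := parallelogram_law_with_norm ℝ v₀ w
    rw [hv₀', hw1] at this
    nlinarith
  have hab : B v₀ v₀ - B w w = B a b := by
    simp only [ha, hb, map_sub, map_add, LinearMap.sub_apply]
    rw [hB w v₀]; ring
  have hb1 : ‖b‖ ≤ 2 := by nlinarith [norm_nonneg a, norm_nonneg b]
  have horth : inner ℝ a b = 0 := by
    rw [ha, hb, inner_sub_left, inner_add_right, inner_add_right, real_inner_self_eq_norm_sq,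
      real_inner_self_eq_norm_sq, hv₀', hw1, real_inner_comm]; ring
  have hp := hall ((4 : ℝ) • a + b)
  have hm := hall ((4 : ℝ) • a - b)
  have hnp : ‖(4 : ℝ) • a + b‖ ^ 2 = 16 * ‖a‖ ^ 2 + ‖b‖ ^ 2 := by
    rw [norm_add_sq_real, norm_smul, inner_smul_left, horth]; norm_num; ring
  have hnm : ‖(4 : ℝ) • a - b‖ ^ 2 = 16 * ‖a‖ ^ 2 + ‖b‖ ^ 2 := by
    rw [norm_sub_sq_real, norm_smul, inner_smul_left, horth]; norm_num; ring
  have hpol : B ((4 : ℝ) • a + b) ((4 : ℝ) • a + b) - B ((4 : ℝ) • a - b) ((4 : ℝ) • a - b)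
      = 16 * B a b := by
    simp only [map_sub, map_add, LinearMap.sub_apply, LinearMap.add_apply, map_smul,
      LinearMap.smul_apply, smul_eq_mul]
    rw [hB b a]; ring
  rw [hnp] at hp
  rw [hnm] at hm
  have ha2 : ‖a‖ ^ 2 ≤ 1 / 4 := by nlinarith [norm_nonneg a]
  have hBab : |B a b| ≤ 31 / 32 * M := by
    have h1 := abs_le.1 hp
    have h2 := abs_le.1 hm
    rw [abs_le]
    constructor <;> nlinarith
  have := abs_le.1 hBab
  have := abs_le.1 hww
  have hMle : M ≤ ε + 31 / 32 * M := by
    rw [hM, abs_le, ← hM]; constructor <;> linarith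
  nlinarith

end net

/-! ### Linear algebra of least squares -/

section matrix

variable {n d : ℕ}

theorem Matrix.measurable_inv_apply {α : Type*} [MeasurableSpace α]
    {F : α → Matrix (Fin d) (Fin d) ℝ} (hF : ∀ i j, Measurable fun a => F a i j) (i j : Fin d) :
    Measurable fun a => (F a)⁻¹ i j := by
  have hdet : ∀ {G : α → Matrix (Fin d) (Fin d) ℝ}, (∀ i j, Measurable fun a => G a i j) →
      Measurable fun a => (G a).det := fun {G} hG => by
    simp only [Matrix.det_apply]
    exact Finset.measurable_sum _ fun s _ =>
      (Finset.measurable_prod _ fun k _ => hG _ _).const_smul _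
  simp only [Matrix.inv_def, Matrix.smul_apply, Ring.inverse_eq_inv', smul_eq_mul,
    Matrix.adjugate_apply]
  refine (hdet hF).inv.mul (hdet fun k l => ?_)
  by_cases h : k = j
  · subst h; simp
  · simpa [Matrix.updateRow_ne h] using hF k l

/-- The residual projection `1 - X (Xᵀ X)⁻¹ Xᵀ` of a design matrix. -/
noncomputable def residualMaker (X : Matrix (Fin n) (Fin d) ℝ) : Matrix (Fin n) (Fin n) ℝ :=
  1 - X * (Xᵀ * X)⁻¹ * Xᵀ

theorem measurable_residualMaker_apply {α : Type*} [MeasurableSpace α]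
    {F : α → Matrix (Fin n) (Fin d) ℝ} (hF : ∀ i j, Measurable fun a => F a i j) (i j : Fin n) :
    Measurable fun a => residualMaker (F a) i j := by
  have hinv := Matrix.measurable_inv_apply (F := fun a => (F a)ᵀ * F a) fun k l => by
    simp only [Matrix.mul_apply, Matrix.transpose_apply]
    exact Finset.measurable_sum _ fun m _ => (hF m k).mul (hF m l)
  have e : ∀ a, residualMaker (F a) i j = (1 : Matrix (Fin n) (Fin n) ℝ) i j -
      ∑ k, (∑ l, F a i l * ((F a)ᵀ * F a)⁻¹ l k) * F a j k := fun a => by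
    rw [residualMaker, Matrix.sub_apply, Matrix.mul_apply]
    simp only [Matrix.mul_apply (M := F a), Matrix.transpose_apply]
  simp only [e]
  exact measurable_const.sub (Finset.measurable_sum _ fun k _ =>
    (Finset.measurable_sum _ fun l _ => (hF i l).mul (hinv l k)).mul (hF j k))

theorem residualMaker_transpose (X : Matrix (Fin n) (Fin d) ℝ) :
    (residualMaker X)ᵀ = residualMaker X := by
  simp [residualMaker, Matrix.transpose_sub, Matrix.transpose_mul, Matrix.transpose_nonsing_inv,
    Matrix.mul_assoc]

/-- Singular Gram matrices are included: their inverse is zero by convention and the projection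
becomes the identity. The noise bound can therefore be applied to every frozen design. -/
theorem residualMaker_mul_self (X : Matrix (Fin n) (Fin d) ℝ) :
    residualMaker X * residualMaker X = residualMaker X := by
  have h : (Xᵀ * X)⁻¹ * (Xᵀ * X) * (Xᵀ * X)⁻¹ = (Xᵀ * X)⁻¹ := by
    by_cases hu : IsUnit (Xᵀ * X).det
    · rw [Matrix.nonsing_inv_mul _ hu, Matrix.one_mul]
    · simp [Matrix.nonsing_inv_apply_not_isUnit _ hu]
  have h2 : X * (Xᵀ * X)⁻¹ * Xᵀ * (X * (Xᵀ * X)⁻¹ * Xᵀ) = X * (Xᵀ * X)⁻¹ * Xᵀ := by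
    calc _ = X * ((Xᵀ * X)⁻¹ * (Xᵀ * X) * (Xᵀ * X)⁻¹) * Xᵀ := by simp only [Matrix.mul_assoc]
      _ = _ := by rw [h]
  rw [residualMaker, Matrix.sub_mul, Matrix.mul_sub, Matrix.mul_sub, h2]
  simp

/-- By symmetry and idempotence the sum is the diagonal entry `p`; it also dominates `p ^ 2`, whence
`p ≤ 1`. -/
theorem sum_sq_residualMaker_le_one (X : Matrix (Fin n) (Fin d) ℝ) (i : Fin n) :
    ∑ j, residualMaker X i j ^ 2 ≤ 1 := by
  have h : ∑ j, residualMaker X i j ^ 2 = residualMaker X i i := by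
    conv_rhs => rw [← residualMaker_mul_self, Matrix.mul_apply]
    refine Finset.sum_congr rfl fun j _ => ?_
    rw [sq]
    congr 1
    conv_lhs => rw [← residualMaker_transpose, Matrix.transpose_apply]
  have h2 : residualMaker X i i ^ 2 ≤ ∑ j, residualMaker X i j ^ 2 :=
    Finset.single_le_sum (f := fun j => residualMaker X i j ^ 2) (fun j _ => sq_nonneg _)
      (Finset.mem_univ i)
  nlinarith

theorem residual_eq {X : Matrix (Fin n) (Fin d) ℝ} (hX : IsUnit (Xᵀ * X)) (b : Fin d → ℝ)
    (z : Fin n → ℝ) (i : Fin n) :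
    X i ⬝ᵥ olsEstimator X (X *ᵥ b + z) - (X *ᵥ b + z) i = -(residualMaker X *ᵥ z) i := by
  have h : X *ᵥ olsEstimator X (X *ᵥ b + z) = X *ᵥ b + (X * (Xᵀ * X)⁻¹ * Xᵀ) *ᵥ z := by
    have e : (Xᵀ * X)⁻¹ *ᵥ (Xᵀ *ᵥ (X *ᵥ b)) = b := by
      rw [Matrix.mulVec_mulVec b, Matrix.mulVec_mulVec,
        Matrix.nonsing_inv_mul _ ((Matrix.isUnit_iff_isUnit_det _).1 hX), Matrix.one_mulVec]
    rw [olsEstimator, Matrix.mulVec_add, Matrix.mulVec_add, e, Matrix.mulVec_add,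
      Matrix.mulVec_mulVec, Matrix.mulVec_mulVec]
  have h1 := congrFun h i
  simp only [Pi.add_apply] at h1 ⊢
  rw [show X i ⬝ᵥ olsEstimator X (X *ᵥ b + z) = _ from h1, residualMaker, Matrix.sub_mulVec,
    Matrix.one_mulVec, Pi.sub_apply]
  ring

theorem gram_quadratic_form (X : Matrix (Fin n) (Fin d) ℝ) (g : Fin d → ℝ) :
    g ⬝ᵥ ((Xᵀ * X) *ᵥ g) = ∑ j, (X j ⬝ᵥ g) ^ 2 := by
  rw [← Matrix.mulVec_mulVec, Matrix.dotProduct_mulVec, Matrix.vecMul_transpose]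
  simp [dotProduct, Matrix.mulVec, sq]

theorem isUnit_gram_of_pos {X : Matrix (Fin n) (Fin d) ℝ}
    (h : ∀ g : Fin d → ℝ, g ≠ 0 → 0 < ∑ j, (X j ⬝ᵥ g) ^ 2) : IsUnit (Xᵀ * X) := by
  refine Matrix.PosDef.isUnit (.of_dotProduct_mulVec_pos ?_ fun g hg => ?_)
  · simpa using Matrix.isHermitian_conjTranspose_mul_self X
  · rw [star_trivial, gram_quadratic_form]
    exact h g hg

/-- Testing with `g = (Xᵀ * X)⁻¹ *ᵥ X i` turns the hypothesis into `h ^ 2 ≤ L * h` for the leverage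
`h`. -/
theorem leverage_le_of_sq_le {X : Matrix (Fin n) (Fin d) ℝ} (hX : IsUnit (Xᵀ * X)) {i : Fin n}
    {L : ℝ} (hL : 0 ≤ L) (h : ∀ g : Fin d → ℝ, (X i ⬝ᵥ g) ^ 2 ≤ L * ∑ j, (X j ⬝ᵥ g) ^ 2) :
    X i ⬝ᵥ ((Xᵀ * X)⁻¹ *ᵥ X i) ≤ L := by
  have h1 := h ((Xᵀ * X)⁻¹ *ᵥ X i)
  rw [← gram_quadratic_form, Matrix.mulVec_mulVec,
    Matrix.mul_nonsing_inv _ ((Matrix.isUnit_iff_isUnit_det _).1 hX), Matrix.one_mulVec,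
    dotProduct_comm ((Xᵀ * X)⁻¹ *ᵥ X i)] at h1
  nlinarith

open scoped MatrixOrder Matrix.Norms.L2Operator in
/-- A positive definite form is the squared norm in suitable linear coordinates. -/
theorem Matrix.PosDef.exists_linearEquiv_norm_sq {M : Matrix (Fin d) (Fin d) ℝ} (hM : M.PosDef) :
    ∃ A : EuclideanSpace ℝ (Fin d) ≃ₗ[ℝ] EuclideanSpace ℝ (Fin d),
      ∀ g, g.ofLp ⬝ᵥ (M *ᵥ g.ofLp) = ‖A g‖ ^ 2 := by
  obtain ⟨B, hB, rfl⟩ := CStarAlgebra.isStrictlyPositive_iff_eq_star_mul_self.1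
    hM.isStrictlyPositive
  have hd := (Matrix.isUnit_iff_isUnit_det _).1 hB
  refine ⟨LinearEquiv.ofLinearMap (Matrix.toLpLin 2 2 B) (Matrix.toLpLin 2 2 B⁻¹) ?_ ?_,
    fun g => ?_⟩
  · rw [← Matrix.toLpLin_mul_same, Matrix.mul_nonsing_inv _ hd, Matrix.toLpLin_one]
  · rw [← Matrix.toLpLin_mul_same, Matrix.nonsing_inv_mul _ hd, Matrix.toLpLin_one]
  · rw [Matrix.star_eq_conjTranspose, Matrix.conjTranspose_eq_transpose_of_trivial,
      gram_quadratic_form, EuclideanSpace.norm_sq_eq]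
    simp [Matrix.mulVec]

end matrix

/-! ### Concentration for subgaussian vectors and noise -/

section concentration

variable {E : Type*} [NormedAddCommGroup E] [InnerProductSpace ℝ E] [FiniteDimensional ℝ E]
  {Ω : Type*} [MeasurableSpace Ω] {P : Measure Ω} {n : ℕ} {u : Fin n → Ω → E}

theorem measureReal_exists_mem_le {ι : Type*} (N : Finset ι) (p : ι → Ω → Prop) {c : ℝ}
    (h : ∀ w ∈ N, P.real {ω | p w ω} ≤ c) : P.real {ω | ∃ w ∈ N, p w ω} ≤ N.card * c := by
  have e : {ω | ∃ w ∈ N, p w ω} = ⋃ w ∈ N, {ω | p w ω} := by ext; simp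
  rw [e]
  calc _ ≤ ∑ w ∈ N, P.real {ω | p w ω} := measureReal_biUnion_finset_le _ _
    _ ≤ ∑ _w ∈ N, c := Finset.sum_le_sum h
    _ = _ := by simp

variable [IsProbabilityMeasure P]

theorem measureReal_exists_norm_sq_gt_le {T : ℝ} (hT : 0 < T)
    (hi : ∀ i (w : E), ‖w‖ = 1 →
      Integrable (fun ω => Real.exp (inner ℝ (u i ω) w ^ 2 / T ^ 2)) P)
    (h2 : ∀ i (w : E), ‖w‖ = 1 → ∫ ω, Real.exp (inner ℝ (u i ω) w ^ 2 / T ^ 2) ∂P ≤ 2)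
    {a : ℝ} (ha : 0 ≤ a) :
    P.real {ω | ∃ i, 4 * (T ^ 2 * a) < ‖u i ω‖ ^ 2} ≤
      n * (5 ^ Module.finrank ℝ E * (2 * Real.exp (-a))) := by
  obtain ⟨N, hcard, hN1, hN⟩ := exists_half_net_sphere (E := E)
  have hone : ∀ i ∈ (Finset.univ : Finset (Fin n)), P.real {ω | 4 * (T ^ 2 * a) < ‖u i ω‖ ^ 2} ≤
      5 ^ Module.finrank ℝ E * (2 * Real.exp (-a)) := fun i _ => by
    calc _ ≤ P.real {ω | ∃ w ∈ N, T ^ 2 * a < inner ℝ (u i ω) w ^ 2} :=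
          measureReal_mono fun ω hω => by
            by_contra hc
            simp only [Set.mem_ofPred_eq, not_exists, not_and, not_lt] at hc hω
            exact hω.not_ge (norm_le_of_half_net hN (by positivity) hc)
      _ ≤ N.card * (2 * Real.exp (-a)) := measureReal_exists_mem_le N _ fun w hw =>
          measureReal_sq_gt_le hT (hi i w (hN1 w hw)) (h2 i w (hN1 w hw)) a
      _ ≤ _ := by
        gcongr
        exact_mod_cast hcard
  simpa using measureReal_exists_mem_le Finset.univ _ hone

variable [MeasurableSpace E] [BorelSpace E]

/-- With high probability the empirical second moment of isotropic subgaussian vectors is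
bounded below by half of the true one, in all directions. -/
theorem measureReal_not_half_le_gram (hu : ∀ i, AEMeasurable (u i) P) (hind : iIndepFun u P)
    {T : ℝ} (hT : 1 ≤ T)
    (hiso : ∀ i (w : E), ‖w‖ = 1 → ∫ ω, inner ℝ (u i ω) w ^ 2 ∂P = 1)
    (hi : ∀ i (w : E), ‖w‖ = 1 →
      Integrable (fun ω => Real.exp (inner ℝ (u i ω) w ^ 2 / T ^ 2)) P)
    (h2 : ∀ i (w : E), ‖w‖ = 1 → ∫ ω, Real.exp (inner ℝ (u i ω) w ^ 2 / T ^ 2) ∂P ≤ 2) :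
    P.real {ω | ¬ ∀ v : E, n / 2 * ‖v‖ ^ 2 ≤ ∑ j, inner ℝ (u j ω) v ^ 2} ≤
      5 ^ Module.finrank ℝ E * (2 * Real.exp (-(n / (262144 * T ^ 4)))) := by
  obtain ⟨N, hcard, hN1, hN⟩ := exists_half_net_sphere (E := E)
  have hT0 : 0 < T := by linarith
  have hT2 : 1 ≤ T ^ 2 := one_le_pow₀ hT
  -- After rescaling by `T ^ 2` the deviation is `n / 64`, which the net factor 32 turns into `n /
  -- 2`. The exponent constant is `64 * 64 ^ 2 = 262144`.
  have htail : ∀ w ∈ N, P.real {ω | n * (1 / (64 * T ^ 2)) ≤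
      |∑ i, inner ℝ (u i ω) w ^ 2 / T ^ 2 - n * (1 / T ^ 2)|} ≤
      2 * Real.exp (-(n / (262144 * T ^ 4))) := fun w hw => by
    have hmeas : Measurable fun v : E => inner ℝ v w ^ 2 / T ^ 2 := by fun_prop
    have hb := measureReal_abs_sum_sub_le (P := P)
      (s := fun i ω => inner ℝ (u i ω) w ^ 2 / T ^ 2) (hind.comp (fun _ => _) fun _ => hmeas)
      (fun i => hmeas.comp_aemeasurable (hu i)) (fun i ω => by positivity)
      (fun i => hi i w (hN1 w hw)) (fun i => h2 i w (hN1 w hw)) (m := 1 / T ^ 2)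
      (fun i => by rw [integral_div, hiso i w (hN1 w hw)]) (δ := 1 / (64 * T ^ 2)) (by positivity)
      ((div_le_one (by positivity)).2 (by linarith) |>.trans (by norm_num))
    refine hb.trans_eq ?_
    congr 3
    field_simp
    norm_num
  have hsub : {ω | ¬ ∀ v : E, n / 2 * ‖v‖ ^ 2 ≤ ∑ j, inner ℝ (u j ω) v ^ 2} ⊆
      {ω | ∃ w ∈ N, n * (1 / (64 * T ^ 2)) ≤
        |∑ i, inner ℝ (u i ω) w ^ 2 / T ^ 2 - n * (1 / T ^ 2)|} := by
    intro ω hω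
    by_contra hc
    simp only [Set.mem_ofPred_eq, not_exists, not_and, not_le] at hc
    refine hω fun v => ?_
    let B : LinearMap.BilinForm ℝ E := ∑ i, (innerₛₗ ℝ (u i ω)).smulRight (innerₛₗ ℝ (u i ω))
      - (n : ℝ) • innerₛₗ ℝ
    have hBval : ∀ x y, B x y = ∑ i, inner ℝ (u i ω) x * inner ℝ (u i ω) y - n * inner ℝ x y :=
      fun x y => by simp [B, LinearMap.sum_apply]
    have hv := abs_bilin_le_of_half_net hN1 hN B (fun x y => by
      rw [hBval, hBval, real_inner_comm]; simp only [mul_comm]) (ε := n / 64) (fun w hw => by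
      have := (hc w hw).le
      rw [← Finset.sum_div, mul_one_div, ← sub_div, abs_div, abs_of_pos (a := T ^ 2) (by positivity),
        div_le_iff₀ (by positivity)] at this
      rw [hBval, real_inner_self_eq_norm_sq, hN1 w hw]
      simp only [← sq, one_pow, mul_one]
      refine this.trans_eq ?_
      field_simp) v
    rw [hBval, real_inner_self_eq_norm_sq] at hv
    simp only [← sq] at hv
    linarith [(abs_le.1 hv).1]
  calc _ ≤ _ := measureReal_mono hsub
    _ ≤ N.card * (2 * Real.exp (-(n / (262144 * T ^ 4)))) := measureReal_exists_mem_le N _ htail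
    _ ≤ _ := by
      gcongr
      exact_mod_cast hcard

/-- Fubini on the product law: a bound uniform over frozen values of `f` survives averaging. -/
theorem measure_prodMk_mem_le_of_indepFun {α β : Type*} [MeasurableSpace α] [MeasurableSpace β]
    {f : Ω → α} {g : Ω → β} (hf : AEMeasurable f P) (hg : AEMeasurable g P) (h : IndepFun f g P)
    {s : Set (α × β)} (hs : MeasurableSet s) {c : ℝ≥0∞}
    (hc : ∀ a, P {ω | (a, g ω) ∈ s} ≤ c) : P {ω | (f ω, g ω) ∈ s} ≤ c := by
  have : IsProbabilityMeasure (P.map f) := Measure.isProbabilityMeasure_map hf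
  have : IsProbabilityMeasure (P.map g) := Measure.isProbabilityMeasure_map hg
  have e : P {ω | (f ω, g ω) ∈ s} = P.map (fun ω => (f ω, g ω)) s :=
    (Measure.map_apply_of_aemeasurable (hf.prodMk hg) hs).symm
  rw [e, h.map_prod_eq_prod_map_map hf hg, Measure.prod_apply hs]
  calc _ ≤ ∫⁻ _, c ∂(P.map f) := lintegral_mono fun a => by
        rw [Measure.map_apply_of_aemeasurable hg (measurable_prodMk_left hs)]
        exact hc a
    _ = c := by simp

theorem IsSubgaussian.integrable_exp_inner {D : Measure E} {K : ℝ} (hD : IsSubgaussian D K)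
    (h0 : ∫ x, x ∂D = 0) (v : E) {T : ℝ} (hT : K * √(covarianceBilin D v v) < T) :
    Integrable (fun x => Real.exp (inner ℝ x v ^ 2 / T ^ 2)) D ∧
      ∫ x, Real.exp (inner ℝ x v ^ 2 / T ^ 2) ∂D ≤ 2 := by
  have hK := hD.one_le
  have h := hD.psi2Norm_le v
  simp only [h0, sub_zero] at h
  refine integrable_exp_of_psi2Norm_lt (by fun_prop) (h.trans_lt ?_)
  exact (ENNReal.ofReal_lt_ofReal_iff_of_nonneg (by positivity)).2 hT

theorem covarianceBilin_self_eq_integral_sq {D : Measure E} [IsProbabilityMeasure D]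
    (hD : MemLp id 2 D) (h0 : ∫ x, x ∂D = 0) (v : E) :
    covarianceBilin D v v = ∫ x, inner ℝ x v ^ 2 ∂D := by
  have hint : Integrable (fun x : E => x) D := hD.integrable (by norm_num)
  rw [covarianceBilin_self hD, variance_of_integral_eq_zero]
  · simp only [real_inner_comm]
  · fun_prop
  · rw [integral_inner hint, h0, inner_zero_right]

end concentration

theorem HasSubgaussianMGF.mono {Ω : Type*} [MeasurableSpace Ω] {P : Measure Ω} {f : Ω → ℝ}
    {c c' : NNReal} (h : HasSubgaussianMGF f c P) (hc : c ≤ c') : HasSubgaussianMGF f c' P :=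
  ⟨h.integrable_exp_mul, fun t => (h.mgf_le t).trans (Real.exp_le_exp.2 (by gcongr))⟩

/-- Tail bound for a linear combination of independent subgaussian noise variables. -/
theorem measureReal_abs_sum_mul_gt_le {N : Measure ℝ} [IsProbabilityMeasure N] {σ K : ℝ}
    (hN : IsSubgaussian N K) (h0 : ∫ z, z ∂N = 0) (hσ : 0 ≤ σ) (hvar : Var[id; N] = σ ^ 2)
    {Ω : Type*} [MeasurableSpace Ω] {P : Measure Ω} [IsProbabilityMeasure P] {n : ℕ}
    {z : Fin n → Ω → ℝ} (hz : ∀ i, HasLaw (z i) N P) (hind : iIndepFun z P)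
    {a : Fin n → ℝ} (ha : ∑ j, a j ^ 2 ≤ 1) {l : ℝ} (hl : 0 ≤ l) :
    P.real {ω | 6 * K * σ * √l < |∑ j, a j * z j ω|} ≤ 2 * Real.exp (-(2 * l)) := by
  have hK := hN.one_le
  -- For `σ = 0` the scale `2 * (K * σ)` degenerates, but the noise vanishes almost surely.
  rcases hσ.eq_or_lt with rfl | hσ
  · have hz0 : ∀ᵐ y ∂N, y = 0 := by
      have h1 := variance_of_integral_eq_zero (X := (id : ℝ → ℝ)) (μ := N) (by fun_prop) h0
      rw [hvar] at h1
      have h2 : Integrable (fun y : ℝ => y ^ 2) N := by simpa using hN.memLp.integrable_sq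
      have h3 := (integral_eq_zero_iff_of_nonneg (fun y => sq_nonneg y) h2).1 (by
        simpa using h1.symm)
      filter_upwards [h3] with y hy
      simpa using hy
    have hall : ∀ᵐ ω ∂P, ∀ j, z j ω = 0 := ae_all_iff.2 fun j =>
      ae_of_ae_map (hz j).aemeasurable (by rw [(hz j).map_eq]; exact hz0)
    have : P.real {ω | 6 * K * 0 * √l < |∑ j, a j * z j ω|} = 0 := by
      rw [measureReal_eq_zero_iff]
      refine measure_mono_null (t := {ω | ¬ ∀ j, z j ω = 0}) (fun ω hω hc => ?_) hall
      have hω' : 6 * K * 0 * √l < |∑ j, a j * z j ω| := hω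
      simp [hc] at hω'
    rw [this]
    positivity
  · have hexp := hN.integrable_exp_inner h0 1 (T := 2 * (K * σ)) (by
      rw [covarianceBilin_eq_variance, hvar, one_pow, one_mul, Real.sqrt_sq hσ.le]
      nlinarith [mul_pos (by linarith : 0 < K) hσ])
    simp only [RCLike.inner_apply, conj_trivial, one_mul] at hexp
    have hs : HasSubgaussianMGF id (2 * (2 * (K * σ)) ^ 2).toNNReal N :=
      hasSubgaussianMGF_of_integral_exp_sq_le_two (by positivity) (by fun_prop)
        (hN.memLp.integrable (by norm_num)) h0 hexp.1 hexp.2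
    set c := (2 * (2 * (K * σ)) ^ 2).toNNReal with hc
    have hcv : (c : ℝ) = 8 * (K * σ) ^ 2 := by
      rw [hc, Real.coe_toNNReal _ (by positivity)]; ring
    have hz' : ∀ j, HasSubgaussianMGF (z j) c P := fun j => by
      have h := hs
      rw [← (hz j).map_eq] at h
      exact h.of_map (X := id) (Y := z j) (hz j).aemeasurable
    have hsum : HasSubgaussianMGF (fun ω => ∑ j, a j * z j ω) c P := by
      refine HasSubgaussianMGF.mono (HasSubgaussianMGF.sum_of_iIndepFun (s := Finset.univ)
        (hind.comp (fun j y => a j * y) fun j => by fun_prop)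
        fun j _ => (hz' j).const_mul (a j)) ?_
      rw [← NNReal.coe_le_coe]
      rw [NNReal.coe_sum]
      calc _ = ∑ j, a j ^ 2 * (c : ℝ) := rfl
        _ ≤ c := by
          rw [← Finset.sum_mul]
          exact mul_le_of_le_one_left c.coe_nonneg ha
    have hR : 0 ≤ 6 * K * σ * √l := by positivity
    -- The variance proxy is `8 * (K * σ) ^ 2`, and `36 / 16 ≥ 2`.
    have hbd : Real.exp (-(6 * K * σ * √l) ^ 2 / (2 * c)) ≤ Real.exp (-(2 * l)) := by
      gcongr
      rw [hcv, mul_pow, Real.sq_sqrt hl, div_le_iff₀ (by positivity)]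
      nlinarith [mul_nonneg (sq_nonneg (K * σ)) hl]
    calc _ ≤ P.real ({ω | 6 * K * σ * √l ≤ ∑ j, a j * z j ω} ∪
          {ω | 6 * K * σ * √l ≤ (-fun ω => ∑ j, a j * z j ω) ω}) :=
          measureReal_mono fun ω hω => by
            rcases lt_abs.1 (show 6 * K * σ * √l < |∑ j, a j * z j ω| from hω) with h | h
            exacts [Or.inl h.le, Or.inr h.le]
      _ ≤ _ := measureReal_union_le _ _
      _ ≤ Real.exp (-(2 * l)) + Real.exp (-(2 * l)) :=
          add_le_add ((hsum.measure_ge_le hR).trans hbd) ((hsum.neg.measure_ge_le hR).trans hbd)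
      _ = _ := by ring

/-! ### Whitening, goodness and the final union bound -/

theorem five_pow_mul_exp_le_one (d : ℕ) : (5 : ℝ) ^ d * Real.exp (-(2 * d)) ≤ 1 := by
  have h5 : (5 : ℝ) ≤ Real.exp 2 := by
    have h := Real.exp_one_gt_d9
    have e : Real.exp 2 = Real.exp 1 * Real.exp 1 := by rw [← Real.exp_add]; norm_num
    rw [e]
    nlinarith
  rw [Real.exp_neg, ← div_eq_mul_inv, div_le_one (Real.exp_pos _), mul_comm, Real.exp_nat_mul]
  gcongr

/-- Whitening: linear images of the covariates which are isotropic and subgaussian. -/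
theorem exists_whitening {d : ℕ} {D : Measure (EuclideanSpace ℝ (Fin d))} [IsProbabilityMeasure D]
    {K : ℝ} (hD : IsSubgaussian D K) (h0 : ∫ x, x ∂D = 0) (hcov : (covMatrix D).PosDef) :
    ∃ (A : EuclideanSpace ℝ (Fin d) ≃ₗ[ℝ] EuclideanSpace ℝ (Fin d))
      (W : EuclideanSpace ℝ (Fin d) →L[ℝ] EuclideanSpace ℝ (Fin d)),
      (∀ x g, inner ℝ (W x) (A g) = inner ℝ x g) ∧
      ∀ w, ‖w‖ = 1 → ∫ x, inner ℝ (W x) w ^ 2 ∂D = 1 ∧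
        Integrable (fun x => Real.exp (inner ℝ (W x) w ^ 2 / (2 * K) ^ 2)) D ∧
        ∫ x, Real.exp (inner ℝ (W x) w ^ 2 / (2 * K) ^ 2) ∂D ≤ 2 := by
  obtain ⟨A, hA⟩ := hcov.exists_linearEquiv_norm_sq
  -- The adjoint of `A⁻¹` whitens: pairing its values with `w` tests `x` against `A⁻¹ w`, whose
  -- variance is `‖w‖ ^ 2`.
  let S := LinearMap.toContinuousLinearMap A.symm.toLinearMap
  have hW : ∀ x w, inner ℝ (S.adjoint x) w = inner ℝ x (A.symm w) := fun x w => by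
    rw [ContinuousLinearMap.adjoint_inner_left]; rfl
  refine ⟨A, S.adjoint, fun x g => by rw [hW, A.symm_apply_apply], fun w hw => ?_⟩
  have hV : covarianceBilin D (A.symm w) (A.symm w) = 1 := by
    rw [covarianceBilin_eq_covMatrix D hD.memLp, hA, A.apply_symm_apply, hw, one_pow]
  simp only [hW]
  refine ⟨by rw [← covarianceBilin_self_eq_integral_sq hD.memLp h0, hV],
    hD.integrable_exp_inner h0 _ ?_⟩
  rw [hV, Real.sqrt_one]
  linarith [hD.one_le]

/-- Goodness of a dataset from lower bounds on the Gram form and bounds on the whitened covariates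
and the projected noise. -/
theorem isGood_of_bounds {n d : ℕ} (hn : 0 < n) {x : Fin n → EuclideanSpace ℝ (Fin d)}
    {z : Fin n → ℝ} (β : EuclideanSpace ℝ (Fin d)) {M R : ℝ} (hM : 0 ≤ M)
    (A : EuclideanSpace ℝ (Fin d) ≃ₗ[ℝ] EuclideanSpace ℝ (Fin d))
    (W : EuclideanSpace ℝ (Fin d) → EuclideanSpace ℝ (Fin d))
    (hWA : ∀ x g, inner ℝ (W x) (A g) = inner ℝ x g)
    (hgram : ∀ v, n / 2 * ‖v‖ ^ 2 ≤ ∑ j, inner ℝ (W (x j)) v ^ 2)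
    (hnorm : ∀ i, ‖W (x i)‖ ^ 2 ≤ M)
    (hres : ∀ i, |(residualMaker (Matrix.of fun i j => x i j) *ᵥ z) i| ≤ R) :
    IsGood (Matrix.of fun i j => x i j) (fun i => inner ℝ β (x i) + z i) (2 / n * M) R := by
  set X : Matrix (Fin n) (Fin d) ℝ := Matrix.of fun i j => x i j with hX
  have hn' : (0 : ℝ) < n := by exact_mod_cast hn
  have hrow : ∀ i (g : Fin d → ℝ), X i ⬝ᵥ g = inner ℝ (W (x i)) (A (WithLp.toLp 2 g)) :=
    fun i g => by
      rw [hWA, EuclideanSpace.inner_eq_star_dotProduct, star_trivial, dotProduct_comm]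
      rfl
  have hlow : ∀ g : Fin d → ℝ, n / 2 * ‖A (WithLp.toLp 2 g)‖ ^ 2 ≤ ∑ j, (X j ⬝ᵥ g) ^ 2 :=
    fun g => by simpa only [hrow] using hgram (A (WithLp.toLp 2 g))
  have hunit : IsUnit (Xᵀ * X) := isUnit_gram_of_pos fun g hg => by
    refine lt_of_lt_of_le ?_ (hlow g)
    have : A (WithLp.toLp 2 g) ≠ 0 := by
      rw [Ne, LinearEquiv.map_eq_zero_iff, WithLp.toLp_eq_zero]
      exact hg
    have := norm_pos_iff.2 this
    positivity
  refine ⟨hunit, fun i => leverage_le_of_sq_le hunit (by positivity) fun g => ?_, fun i => ?_⟩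
  · calc (X i ⬝ᵥ g) ^ 2 ≤ ‖W (x i)‖ ^ 2 * ‖A (WithLp.toLp 2 g)‖ ^ 2 := by
          rw [hrow, ← mul_pow, ← sq_abs]
          gcongr
          exact abs_real_inner_le_norm _ _
      _ ≤ M * ‖A (WithLp.toLp 2 g)‖ ^ 2 := by
          gcongr
          exact hnorm i
      _ = 2 / n * M * (n / 2 * ‖A (WithLp.toLp 2 g)‖ ^ 2) := by field_simp
      _ ≤ _ := by
          gcongr
          exact hlow g
  · have hy : (fun i => inner ℝ β (x i) + z i) = X *ᵥ β.ofLp + z := by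
      ext i
      rw [Pi.add_apply, EuclideanSpace.inner_eq_star_dotProduct, star_trivial]
      rfl
    have hyi : inner ℝ β (x i) + z i = (X *ᵥ β.ofLp + z) i := congrFun hy i
    rw [hy, hyi, residual_eq hunit, abs_neg]
    exact hres i

theorem measureReal_exists_residual_gt_le {n d : ℕ} {Ω : Type*} [MeasurableSpace Ω]
    {P : Measure Ω} [IsProbabilityMeasure P] {x : Fin n → Ω → EuclideanSpace ℝ (Fin d)}
    (hx : ∀ i, AEMeasurable (x i) P) {N : Measure ℝ} [IsProbabilityMeasure N] {σ K : ℝ}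
    (hN : IsSubgaussian N K) (h0 : ∫ z, z ∂N = 0) (hσ : 0 ≤ σ) (hvar : Var[id; N] = σ ^ 2)
    {z : Fin n → Ω → ℝ} (hz : ∀ i, HasLaw (z i) N P) (hind : iIndepFun z P)
    (hxz : IndepFun (fun ω i => x i ω) (fun ω i => z i ω) P) {l : ℝ} (hl : 0 ≤ l) :
    P.real {ω | ∃ i, 6 * K * σ * √l <
      |(residualMaker (Matrix.of fun i j => x i ω j) *ᵥ fun i => z i ω) i|} ≤
      n * (2 * Real.exp (-(2 * l))) := by
  set R := 6 * K * σ * √l with hR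
  have hone : ∀ i ∈ (Finset.univ : Finset (Fin n)), P.real {ω | R <
      |(residualMaker (Matrix.of fun i j => x i ω j) *ᵥ fun i => z i ω) i|} ≤
      2 * Real.exp (-(2 * l)) := fun i _ => by
    let r : (Fin n → EuclideanSpace ℝ (Fin d)) → Fin n → ℝ := fun a =>
      residualMaker (Matrix.of fun i j => a i j) i
    have hr : ∀ j, Measurable fun a => r a j := fun j => measurable_residualMaker_apply
      (F := fun a : Fin n → EuclideanSpace ℝ (Fin d) => Matrix.of fun i j => a i j)
      (fun k l => by simp only [Matrix.of_apply]; fun_prop) i j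
    have hr1 : ∀ a, ∑ j, r a j ^ 2 ≤ 1 := fun a => sum_sq_residualMaker_le_one _ i
    change P.real {ω | R < |∑ j, r (fun i => x i ω) j * z j ω|} ≤ _
    clear_value r
    let s : Set ((Fin n → EuclideanSpace ℝ (Fin d)) × (Fin n → ℝ)) :=
      {p | R < ‖∑ j, r p.1 j * p.2 j‖}
    have hs : MeasurableSet s := measurableSet_lt measurable_const
      (Finset.measurable_sum _ fun j _ => ((hr j).comp measurable_fst).mul
          ((measurable_pi_apply j).comp measurable_snd)).norm
    have h : P {ω | ((fun i => x i ω), (fun i => z i ω)) ∈ s} ≤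
        ENNReal.ofReal (2 * Real.exp (-(2 * l))) :=
      measure_prodMk_mem_le_of_indepFun (aemeasurable_pi_lambda _ hx)
        (aemeasurable_pi_lambda _ fun i => (hz i).aemeasurable) hxz hs fun a => by
          rw [ENNReal.le_ofReal_iff_toReal_le (measure_ne_top _ _) (by positivity)]
          exact measureReal_abs_sum_mul_gt_le hN h0 hσ hvar hz hind (hr1 a) hl
    exact ENNReal.toReal_le_of_le_ofReal (by positivity) h
  simpa using measureReal_exists_mem_le Finset.univ _ hone

theorem mainTheorem10 :
    ∃ K_L K_R K_n : ℝ, 0 < K_L ∧ 0 < K_R ∧ 0 < K_n ∧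
      ∀ (n d : ℕ)
        -- the covariate distribution: mean zero, full-rank covariance, subgaussian
        (D : Measure (EuclideanSpace ℝ (Fin d))) [IsProbabilityMeasure D] (K_D : ℝ),
        IsSubgaussian D K_D → ∫ x, x ∂D = 0 → (covMatrix D).PosDef →
      ∀ -- the noise distribution: mean zero, variance `σ ^ 2`, subgaussian
        (N : Measure ℝ) [IsProbabilityMeasure N] (σ K_σ : ℝ),
        IsSubgaussian N K_σ → ∫ z, z ∂N = 0 → 0 ≤ σ → Var[id; N] = σ ^ 2 →
      ∀ -- the sample: i.i.d. covariates, i.i.d. noise, noise independent of the covariates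
        {Ω : Type*} [MeasurableSpace Ω] (μ : Measure Ω) [IsProbabilityMeasure μ]
        (x : Fin n → Ω → EuclideanSpace ℝ (Fin d)) (z : Fin n → Ω → ℝ),
        (∀ i, HasLaw (x i) D μ) → iIndepFun x μ →
        (∀ i, HasLaw (z i) N μ) → iIndepFun z μ →
        IndepFun (fun ω i => x i ω) (fun ω i => z i ω) μ →
      ∀ (β : EuclideanSpace ℝ (Fin d)) (η : ℝ), 0 < η → η < 1 →
        K_n * K_D ^ 4 * (d + Real.log (3 / η)) ≤ n →
        ENNReal.ofReal (1 - η) ≤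
          μ {ω | IsGood (Matrix.of fun i j => x i ω j) (fun i => inner ℝ β (x i ω) + z i ω)
            (K_L * K_D ^ 2 * ((d + Real.log (3 * n / η)) / n))
            (K_R * K_σ * σ * √(Real.log (3 * n / η)))} := by
  -- With `T = 2 * K`: `64 = 2 * 4 * 2 ^ 2 * 2` comes from leverage, and `8388608 = 2 * 262144 * 2 ^
  -- 4` from the Gram bound.
  refine ⟨64, 6, 8388608, by norm_num, by norm_num, by norm_num, ?_⟩
  intro n d D _ K hD hD0 hcov N _ σ Kσ hN hN0 hσ hvar Ω _ μ _ x z hx hxi hz hzi hxz β η hη hη1 hn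
  have hK := hD.one_le
  have hl0 : 0 < Real.log (3 / η) := Real.log_pos (by rw [lt_div_iff₀ hη]; linarith)
  have hn' : (0 : ℝ) < n := lt_of_lt_of_le (by positivity) hn
  have hnpos : 0 < n := by exact_mod_cast hn'
  have hn1 : (1 : ℝ) ≤ n := by exact_mod_cast hnpos
  have hexp0 : Real.exp (-Real.log (3 / η)) = η / 3 := by
    rw [Real.exp_neg, Real.exp_log (by positivity), inv_div]
  have hexp : Real.exp (-Real.log (3 * n / η)) = η / (3 * n) := by
    rw [Real.exp_neg, Real.exp_log (by positivity), inv_div]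
  have hl : 0 ≤ Real.log (3 * n / η) := Real.log_nonneg (by
    rw [le_div_iff₀ hη]; linarith)
  set l := Real.log (3 * n / η) with hldef
  set l0 := Real.log (3 / η)
  have hexp2 : ∀ t : ℝ, Real.exp (-(2 * t)) = Real.exp (-t) ^ 2 := fun t => by
    rw [← Real.exp_nat_mul]; push_cast; ring_nf
  -- Doubling `l` squares `η / (3 * n)`, which pays for the union over `n` samples and the factor 2.
  have hsmall : n * (2 * Real.exp (-(2 * l))) ≤ η / 3 := by
    rw [hexp2, hexp]
    have e : n * (2 * (η / (3 * n)) ^ 2) = η / 3 * (2 * η / (3 * n)) := by field_simp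
    rw [e]
    exact mul_le_of_le_one_right (by positivity)
      ((div_le_one (by positivity)).2 (by linarith))
  obtain ⟨A, W, hWA, hW⟩ := exists_whitening hD hD0 hcov
  have hu : ∀ i, AEMeasurable (fun ω => W (x i ω)) μ := fun i =>
    W.measurable.comp_aemeasurable (hx i).aemeasurable
  have hui : iIndepFun (fun i ω => W (x i ω)) μ := hxi.comp (fun _ => W) fun _ => W.measurable
  have hcomp : ∀ i {f : EuclideanSpace ℝ (Fin d) → ℝ}, Measurable f →
      ∫ ω, f (x i ω) ∂μ = ∫ y, f y ∂D := fun i f hf =>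
    (hx i).integral_comp hf.aestronglyMeasurable
  have hiso : ∀ i (w : EuclideanSpace ℝ (Fin d)), ‖w‖ = 1 →
      ∫ ω, inner ℝ (W (x i ω)) w ^ 2 ∂μ = 1 := fun i w hw => by
    rw [hcomp i (f := fun y => inner ℝ (W y) w ^ 2) (by fun_prop), (hW w hw).1]
  have hi : ∀ i (w : EuclideanSpace ℝ (Fin d)), ‖w‖ = 1 →
      Integrable (fun ω => Real.exp (inner ℝ (W (x i ω)) w ^ 2 / (2 * K) ^ 2)) μ :=
    fun i w hw => by
      have h := (hW w hw).2.1
      rw [← (hx i).map_eq] at h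
      exact h.comp_aemeasurable (hx i).aemeasurable
  have h2 : ∀ i (w : EuclideanSpace ℝ (Fin d)), ‖w‖ = 1 →
      ∫ ω, Real.exp (inner ℝ (W (x i ω)) w ^ 2 / (2 * K) ^ 2) ∂μ ≤ 2 := fun i w hw => by
    rw [hcomp i (f := fun y => Real.exp (inner ℝ (W y) w ^ 2 / (2 * K) ^ 2)) (by fun_prop)]
    exact (hW w hw).2.2
  set R := 6 * Kσ * σ * √l with hR
  let badGram : Set Ω := {ω | ¬ ∀ v, n / 2 * ‖v‖ ^ 2 ≤ ∑ j, inner ℝ (W (x j ω)) v ^ 2}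
  let badNorm : Set Ω := {ω | ∃ i, 4 * ((2 * K) ^ 2 * (2 * d + 2 * l)) < ‖W (x i ω)‖ ^ 2}
  let badNoise : Set Ω := {ω | ∃ i,
    R < |(residualMaker (Matrix.of fun i j => x i ω j) *ᵥ fun i => z i ω) i|}
  have hgram : μ.real badGram ≤ η / 3 := by
    have h := measureReal_not_half_le_gram hu hui (T := 2 * K) (by linarith) hiso hi h2
    rw [finrank_euclideanSpace_fin] at h
    have hlarge : 2 * d + 2 * l0 ≤ n / (262144 * (2 * K) ^ 4) := by
      rw [le_div_iff₀ (by positivity)]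
      refine le_trans (le_of_eq ?_) hn
      ring
    calc μ.real badGram ≤ _ := h
      _ ≤ 5 ^ d * (2 * Real.exp (-(2 * d + 2 * l0))) := by gcongr
      _ = 5 ^ d * Real.exp (-(2 * d)) * (2 * Real.exp (-(2 * l0))) := by
        rw [neg_add, Real.exp_add]; ring
      _ ≤ 1 * (2 * Real.exp (-(2 * l0))) := by
        gcongr
        exact five_pow_mul_exp_le_one d
      _ ≤ η / 3 := by
        rw [hexp2, hexp0]
        nlinarith
  have hnorm : μ.real badNorm ≤ η / 3 := by
    have h := measureReal_exists_norm_sq_gt_le (P := μ) (u := fun i ω => W (x i ω)) (T := 2 * K)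
      (by linarith) hi h2 (a := 2 * d + 2 * l) (by positivity)
    rw [finrank_euclideanSpace_fin] at h
    calc μ.real badNorm ≤ _ := h
      _ = 5 ^ d * Real.exp (-(2 * d)) * (n * (2 * Real.exp (-(2 * l)))) := by
        rw [neg_add, Real.exp_add]; ring
      _ ≤ 1 * (n * (2 * Real.exp (-(2 * l)))) := by
        gcongr
        exact five_pow_mul_exp_le_one d
      _ ≤ η / 3 := by rwa [one_mul]
  have hnoise : μ.real badNoise ≤ η / 3 := by
    exact (measureReal_exists_residual_gt_le (fun i => (hx i).aemeasurable) hN hN0 hσ hvar hz hzi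
      hxz hl).trans hsmall
  have hbad : μ (badGram ∪ badNorm ∪ badNoise) ≤ ENNReal.ofReal η := by
    rw [ENNReal.le_ofReal_iff_toReal_le (measure_ne_top _ _) hη.le]
    have h1 := measureReal_union_le (μ := μ) (badGram ∪ badNorm) badNoise
    have h2 := measureReal_union_le (μ := μ) badGram badNorm
    exact (show μ.real _ ≤ η by linarith)
  set G := {ω | IsGood (Matrix.of fun i j => x i ω j) (fun i => inner ℝ β (x i ω) + z i ω)
            (64 * K ^ 2 * ((d + l) / n)) R}
  -- Covering the space and using subadditivity avoids any measurability claim about `G`.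
  have hsub : Set.univ ⊆ G ∪ (badGram ∪ badNorm ∪ badNoise) := fun ω _ => by
    by_contra hc
    simp only [Set.mem_union, not_or] at hc
    obtain ⟨hG, ⟨hA', hB'⟩, hC'⟩ := hc
    refine hG ?_
    have hgood := isGood_of_bounds hnpos (x := fun i => x i ω) (z := fun i => z i ω) β (R := R)
      (M := 4 * ((2 * K) ^ 2 * (2 * d + 2 * l))) (by positivity) A W hWA (not_not.1 hA')
      (fun i => not_lt.1 fun h => hB' ⟨i, h⟩)
      (fun i => not_lt.1 fun h => hC' ⟨i, h⟩)
    have e : 2 / n * (4 * ((2 * K) ^ 2 * (2 * d + 2 * l))) = 64 * K ^ 2 * ((d + l) / n) := by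
      ring
    rw [e] at hgood
    exact hgood
  rw [ENNReal.ofReal_sub _ hη.le, ENNReal.ofReal_one, tsub_le_iff_right]
  calc (1 : ℝ≥0∞) = μ Set.univ := measure_univ.symm
    _ ≤ _ := measure_mono hsub
    _ ≤ _ := measure_union_le _ _
    _ ≤ _ := by gcongr
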